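/- Let $G$ be a finite group and let $[G/G]$ be the (zero-dimensional, compact) orbifold presented by the action groupoid $\mathcal G$ of $G$ acting on itself by conjugation. Let $\tilde{\mathcal G}$ be its inertia groupoid (pairs $(x,g)$ of an object $x$ of $\mathcal G$ and a loop $g$ at $x$), let $\tilde{\mathcal G}^{[2]}$ be the groupoid of $2$-sectors $(x,g_1,g_2)$, and let $e_1,e_2,e_{12}:\tilde{\mathcal G}^{[2]}\to\tilde{\mathcal G}$ be the evaluation maps sending $(x,g_1,g_2)$ to $(x,g_1)$, $(x,g_2)$ and $(x,g_1g_2)$. The Chen–Ruan cohomology $H_{CR}([G/G],\mathbb C)$ is the de Rham cohomology $H^*(\tilde{\mathcal G},\mathbb C)$ with the product $$\omega_1 *_{CR}\omega_2=(e_{12})_*\bigl(e_1^*\omega_1\cup e_2^*\omega_2\cup e(E^{[2]})\bigr),$$ where $(e_{12})_*$ is the push-forward given by orbifold integration over the fibres and $e(E^{[2]})$ is the Euler class of the Chen–Ruan obstruction bundle $E^{[2]}$ over $\tilde{\mathcal G}^{[2]}$. Let $\tilde G=\{(g,h)\in G\times G : gh=hg\}$, with $G$ acting by simultaneous conjugation,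 and let $\mathcal C_G(\tilde G)$ be the complex vector space of $G$-invariant functions $\tilde G\to\mathbb C$. With the product $$(f_1 *_2 f_2)(g,h)=\sum_{\substack{h_1,h_2\in Z_G(g)\\ h_1h_2=h}} f_1(g,h_1)\,f_2(g,h_2),$$ where $Z_G(g)$ is the centralizer of $g$ in $G$, it is a ring. Then there is a ($\mathbb C$-linear) ring isomorphism $$\bigl(H_{CR}([G/G],\mathbb C),\,*_{CR}\bigr)\;\cong\;\bigl(\mathcal C_G(\tilde G),\,*_2\bigr).$$ -/

import Mathlib

open CategoryTheory DirectSum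

noncomputable section

namespace ChenRuan

universe u v w

/-!
## Compact orbifolds of dimension zero

A compact zero-dimensional orbifold is presented by a groupoid `𝒢` with finitely many objects and
finitely many arrows between any two objects: the discrete manifolds `𝒢₀`, `𝒢₁` then form a
proper étale Lie groupoid with compact orbit space.  Composition of arrows is written in
diagrammatic order `f ≫ g`, that is, `g₁ · g₂` with `t g₁ = s g₂`.
-/

/-! ### Multi-sectors -/

/-- Objects of the groupoid of `k`-sectors: a point with a `k`-tuple of loops at it.
For `k = 1` this is the inertia groupoid. -/
structure Sector (𝒢 : Type u) [Groupoid.{v} 𝒢] (k : ℕ) where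
  pt : 𝒢
  loop : Fin k → (pt ⟶ pt)

/-- Arrows of the groupoid of `k`-sectors: an arrow `h` of `𝒢` leads from `(g₁, …, g_k)` to
`(h⁻¹ g₁ h, …, h⁻¹ g_k h)`. -/
instance (𝒢 : Type u) [Groupoid.{v} 𝒢] (k : ℕ) : Groupoid.{v} (Sector 𝒢 k) where
  Hom a b := {h : a.pt ⟶ b.pt // ∀ i, b.loop i = Groupoid.inv h ≫ a.loop i ≫ h}
  id a := ⟨𝟙 a.pt, fun i => by simp⟩
  comp f g := ⟨f.1 ≫ g.1, fun i => by rw [g.2 i, f.2 i]; simp⟩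
  inv f := ⟨Groupoid.inv f.1, fun i => by rw [f.2 i]; simp⟩
  id_comp f := Subtype.ext (Category.id_comp f.1)
  comp_id f := Subtype.ext (Category.comp_id f.1)
  assoc f g h := Subtype.ext (Category.assoc f.1 g.1 h.1)
  inv_comp f := Subtype.ext (Groupoid.inv_comp f.1)
  comp_inv f := Subtype.ext (Groupoid.comp_inv f.1)

section Sectors

variable (𝒢 : Type u) [Groupoid.{v} 𝒢]

/-- The inertia groupoid. -/
abbrev Inertia := Sector 𝒢 1

/-- The evaluation `e₁ : (x, g₁, g₂) ↦ (x, g₁)`. -/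
def e₁ : Sector 𝒢 2 ⥤ Inertia 𝒢 where
  obj a := ⟨a.pt, fun _ => a.loop 0⟩
  map h := ⟨h.1, fun _ => h.2 0⟩

/-- The evaluation `e₂ : (x, g₁, g₂) ↦ (x, g₂)`. -/
def e₂ : Sector 𝒢 2 ⥤ Inertia 𝒢 where
  obj a := ⟨a.pt, fun _ => a.loop 1⟩
  map h := ⟨h.1, fun _ => h.2 1⟩

/-- The evaluation `e₁₂ : (x, g₁, g₂) ↦ (x, g₁ g₂)`. -/
def e₁₂ : Sector 𝒢 2 ⥤ Inertia 𝒢 where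
  obj a := ⟨a.pt, fun _ => a.loop 0 ≫ a.loop 1⟩
  map {a b} h := ⟨h.1, fun _ => by
    show b.loop 0 ≫ b.loop 1 = _
    rw [h.2 0, h.2 1]; simp⟩

/-- The involution `(x, g) ↦ (x, g⁻¹)` on objects of the inertia groupoid. -/
def invol {𝒢 : Type u} [Groupoid.{v} 𝒢] (a : Inertia 𝒢) : Inertia 𝒢 :=
  ⟨a.pt, fun i => Groupoid.inv (a.loop i)⟩

end Sectors

instance (𝒢 : Type u) [Groupoid.{v} 𝒢] (k : ℕ) [Finite 𝒢] [∀ x y : 𝒢, Finite (x ⟶ y)] :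
    Finite (Sector 𝒢 k) :=
  Finite.of_injective (β := Σ x : 𝒢, Fin k → (x ⟶ x)) (fun a => ⟨a.pt, a.loop⟩) (by
    rintro ⟨a, l⟩ ⟨b, m⟩ h
    cases h
    rfl)

instance (𝒢 : Type u) [Groupoid.{v} 𝒢] (k : ℕ) [∀ x y : 𝒢, Finite (x ⟶ y)]
    (a b : Sector 𝒢 k) : Finite (a ⟶ b) :=
  inferInstanceAs
    (Finite {h : a.pt ⟶ b.pt // ∀ i, b.loop i = Groupoid.inv h ≫ a.loop i ≫ h})

/-! ### Tangent spaces and differential forms -/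

/-- The (complex) tangent space at any point of a manifold of dimension zero. -/
abbrev Tan := EuclideanSpace ℂ (Fin 0)

/-- The action of an arrow `x ⟶ y` of an étale groupoid of dimension zero on tangent spaces,
i.e. the derivative of the germ of a diffeomorphism it defines.  There is only one linear map
between the zero spaces `T_x 𝒢₀` and `T_y 𝒢₀`. -/
def tangentMap {𝒢 : Type u} [Groupoid.{v} 𝒢] {x y : 𝒢} (_ : x ⟶ y) : Tan →L[ℂ] Tan :=
  ContinuousLinearMap.id ℂ Tan

/-- The `𝒢`-invariant complex-valued differential `p`-forms on `𝒢₀`, i.e. those with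
`s^* ω = t^* ω` on `𝒢₁`. -/
def formSubmodule (𝒢 : Type u) [Groupoid.{v} 𝒢] (p : ℕ) :
    Submodule ℂ (𝒢 → Tan [⋀^Fin p]→L[ℝ] ℂ) where
  carrier := {ω | ∀ (x y : 𝒢) (f : x ⟶ y),
    (ω y).compContinuousLinearMap ((tangentMap f).restrictScalars ℝ) = ω x}
  zero_mem' := fun _ _ _ => by ext; rfl
  add_mem' := fun ha hb x y f => by
    rw [Pi.add_apply, Pi.add_apply, ← ha x y f, ← hb x y f]; rfl
  smul_mem' := fun c a ha x y f => by
    rw [Pi.smul_apply, Pi.smul_apply, ← ha x y f]; rfl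

/-- The space of invariant `p`-forms. -/
def Form (𝒢 : Type u) [Groupoid.{v} 𝒢] (p : ℕ) : Type u := formSubmodule 𝒢 p

instance (𝒢 : Type u) [Groupoid.{v} 𝒢] (p : ℕ) : AddCommGroup (Form 𝒢 p) :=
  inferInstanceAs (AddCommGroup (formSubmodule 𝒢 p))

instance (𝒢 : Type u) [Groupoid.{v} 𝒢] (p : ℕ) : Module ℂ (Form 𝒢 p) :=
  inferInstanceAs (Module ℂ (formSubmodule 𝒢 p))

section Cohomology

variable (𝒢 : Type u) [Groupoid.{v} 𝒢]

theorem form_map {𝒢 : Type u} [Groupoid.{v} 𝒢] {p : ℕ} (ω : Form 𝒢 p) {x y : 𝒢} (f : x ⟶ y) :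
    ω.1 y = ω.1 x := by
  rw [← ω.2 x y f]; ext; rfl

theorem mem_form {𝒢 : Type u} [Groupoid.{v} 𝒢] {p : ℕ} (ω : 𝒢 → Tan [⋀^Fin p]→L[ℝ] ℂ)
    (h : ∀ (x y : 𝒢), (x ⟶ y) → ω y = ω x) : ω ∈ formSubmodule 𝒢 p := by
  intro x y f
  rw [← h x y f]; ext; rfl

instance subsingleton_alt (p : ℕ) : Subsingleton (Tan [⋀^Fin (p + 1)]→L[ℝ] ℂ) :=
  ⟨fun a b => by
    ext m
    rw [Subsingleton.elim m 0, a.map_zero, b.map_zero]⟩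

instance subsingleton_form (p : ℕ) : Subsingleton (Form 𝒢 (p + 1)) :=
  ⟨fun _ _ => Subtype.ext (funext fun _ => Subsingleton.elim _ _)⟩

/-- The exterior derivative.  In the chart `{x} ≅ ℝ⁰` at a point `x` the form `ω` is the form on
the zero vector space which takes the value `ω x`. -/
def dForm (p : ℕ) : Form 𝒢 p →ₗ[ℂ] Form 𝒢 (p + 1) where
  toFun ω := ⟨fun x => extDeriv (fun _ : Tan => ω.1 x) 0,
    mem_form _ fun x y f => by rw [form_map ω f]⟩
  map_add' _ _ := Subsingleton.elim _ _
  map_smul' _ _ := Subsingleton.elim _ _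

/-- Exact `p`-forms. -/
def exact : (p : ℕ) → Submodule ℂ (Form 𝒢 p)
  | 0 => ⊥
  | p + 1 => LinearMap.range (dForm 𝒢 p)

/-- The de Rham cohomology `H^p(𝒢, ℂ)`: closed invariant forms modulo exact ones. -/
abbrev deRham (p : ℕ) : Type u :=
  LinearMap.ker (dForm 𝒢 p) ⧸ (exact 𝒢 p).comap (LinearMap.ker (dForm 𝒢 p)).subtype

theorem exact_eq_bot (p : ℕ) : exact 𝒢 p = ⊥ := by
  cases p with
  | zero => rfl
  | succ p => exact Subsingleton.elim _ _

theorem mem_ker_dForm (p : ℕ) (ω : Form 𝒢 p) : ω ∈ LinearMap.ker (dForm 𝒢 p) :=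
  Subsingleton.elim _ _

variable {𝒢}

/-- The cohomology class of a form (each form is closed, see `mem_ker_dForm`). -/
def cls (p : ℕ) : Form 𝒢 p →ₗ[ℂ] deRham 𝒢 p :=
  (Submodule.mkQ _).comp (LinearMap.id.codRestrict (LinearMap.ker (dForm 𝒢 p))
    (mem_ker_dForm 𝒢 p))

theorem exact_le_ker {M : Type w} [AddCommGroup M] [Module ℂ M] {p : ℕ} (F : Form 𝒢 p →ₗ[ℂ] M) :
    (exact 𝒢 p).comap (LinearMap.ker (dForm 𝒢 p)).subtype ≤
      LinearMap.ker (F.comp (LinearMap.ker (dForm 𝒢 p)).subtype) := by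
  rintro ⟨ω, hω⟩ h
  have h' : ω ∈ exact 𝒢 p := h
  rw [exact_eq_bot, Submodule.mem_bot] at h'
  subst h'
  exact F.map_zero

/-- A linear map on forms descends to cohomology if it kills the exact forms; here there are
none but `0`. -/
def descend {M : Type w} [AddCommGroup M] [Module ℂ M] {p : ℕ} (F : Form 𝒢 p →ₗ[ℂ] M) :
    deRham 𝒢 p →ₗ[ℂ] M :=
  Submodule.liftQ _ (F.comp (LinearMap.ker (dForm 𝒢 p)).subtype) (exact_le_ker F)

/-! ### Cup product -/

/-- The wedge product of alternating forms on the tangent space. -/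
def wedge {p q : ℕ} (a : Tan [⋀^Fin p]→L[ℝ] ℂ) (b : Tan [⋀^Fin q]→L[ℝ] ℂ) :
    Tan [⋀^Fin (p + q)]→L[ℝ] ℂ :=
  let c : Tan [⋀^Fin (p + q)]→ₗ[ℝ] ℂ :=
    ((LinearMap.mul' ℝ ℂ).compAlternatingMap
      (a.toAlternatingMap.domCoprod b.toAlternatingMap)).domDomCongr finSumFinEquiv
  { c with cont := continuous_of_const fun v w => congrArg c (Subsingleton.elim v w) }

theorem wedge_apply {p q : ℕ} (a : Tan [⋀^Fin p]→L[ℝ] ℂ) (b : Tan [⋀^Fin q]→L[ℝ] ℂ)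
    (v : Fin (p + q) → Tan) :
    wedge a b v = LinearMap.mul' ℝ ℂ (AlternatingMap.domCoprod' 
      (a.toAlternatingMap ⊗ₜ[ℝ] b.toAlternatingMap) (v ∘ finSumFinEquiv)) := rfl

theorem wedge_add_left {p q : ℕ} (a a' : Tan [⋀^Fin p]→L[ℝ] ℂ) (b : Tan [⋀^Fin q]→L[ℝ] ℂ) :
    wedge (a + a') b = wedge a b + wedge a' b := by
  ext v
  rw [ContinuousAlternatingMap.add_apply]
  simp only [wedge_apply]
  rw [show (a + a').toAlternatingMap = a.toAlternatingMap + a'.toAlternatingMap from rfl,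
    TensorProduct.add_tmul, map_add, AlternatingMap.add_apply, map_add]

theorem wedge_add_right {p q : ℕ} (a : Tan [⋀^Fin p]→L[ℝ] ℂ) (b b' : Tan [⋀^Fin q]→L[ℝ] ℂ) :
    wedge a (b + b') = wedge a b + wedge a b' := by
  ext v
  rw [ContinuousAlternatingMap.add_apply]
  simp only [wedge_apply]
  rw [show (b + b').toAlternatingMap = b.toAlternatingMap + b'.toAlternatingMap from rfl,
    TensorProduct.tmul_add, map_add, AlternatingMap.add_apply, map_add]

/-- The wedge product of invariant forms. -/
def wedgeForm {p q : ℕ} (a : Form 𝒢 p) (b : Form 𝒢 q) : Form 𝒢 (p + q) :=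
  ⟨fun x => wedge (a.1 x) (b.1 x), mem_form _ fun x y f => by rw [form_map a f, form_map b f]⟩

theorem cls_surjective (p : ℕ) : Function.Surjective (cls (𝒢 := 𝒢) p) := by
  intro a
  obtain ⟨⟨ω, hω⟩, rfl⟩ := Submodule.mkQ_surjective _ a
  exact ⟨ω, rfl⟩

theorem cls_injective (p : ℕ) : Function.Injective (cls (𝒢 := 𝒢) p) := by
  intro a b h
  have h' := (Submodule.Quotient.eq _).1 h
  have h'' : a - b ∈ exact 𝒢 p := h'
  rw [exact_eq_bot, Submodule.mem_bot] at h''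
  exact sub_eq_zero.1 h''

/-- The cup product of de Rham classes: `[a] ∪ [b] = [a ∧ b]`. -/
def cup {p q : ℕ} (a : deRham 𝒢 p) (b : deRham 𝒢 q) : deRham 𝒢 (p + q) :=
  Quotient.liftOn₂' a b (fun a b => cls (p + q) (wedgeForm a.1 b.1)) (by
    intro a b a' b' ha hb
    have h1 : a.1 = a'.1 := cls_injective p (Quotient.sound' ha)
    have h2 : b.1 = b'.1 := cls_injective q (Quotient.sound' hb)
    rw [h1, h2])

theorem cup_cls {p q : ℕ} (a : Form 𝒢 p) (b : Form 𝒢 q) :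
    cup (cls p a) (cls q b) = cls (p + q) (wedgeForm a b) := rfl

theorem cup_add {p q : ℕ} (a : deRham 𝒢 p) (b b' : deRham 𝒢 q) :
    cup a (b + b') = cup a b + cup a b' := by
  obtain ⟨a, rfl⟩ := cls_surjective p a
  obtain ⟨b, rfl⟩ := cls_surjective q b
  obtain ⟨b', rfl⟩ := cls_surjective q b'
  rw [← map_add, cup_cls, cup_cls, cup_cls, ← map_add]
  exact congrArg _ (Subtype.ext (funext fun x => wedge_add_right _ _ _))

theorem add_cup {p q : ℕ} (a a' : deRham 𝒢 p) (b : deRham 𝒢 q) :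
    cup (a + a') b = cup a b + cup a' b := by
  obtain ⟨a, rfl⟩ := cls_surjective p a
  obtain ⟨a', rfl⟩ := cls_surjective p a'
  obtain ⟨b, rfl⟩ := cls_surjective q b
  rw [← map_add, cup_cls, cup_cls, cup_cls, ← map_add]
  exact congrArg _ (Subtype.ext (funext fun x => wedge_add_left _ _ _))

instance : DirectSum.GNonUnitalNonAssocSemiring (deRham 𝒢) where
  mul := cup
  mul_zero a := by simpa using cup_add a 0 0
  zero_mul b := by simpa using add_cup 0 0 b
  mul_add := cup_add
  add_mul := add_cup

end Cohomology

/-- The total de Rham cohomology `H^*(𝒢, ℂ) = ⨁_p H^p(𝒢, ℂ)`; its multiplication is the cup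
product. -/
abbrev deRhamTotal (𝒢 : Type u) [Groupoid.{v} 𝒢] : Type u := ⨁ p : ℕ, deRham 𝒢 p

/-! ### Pull-back and push-forward -/

section Functoriality

variable {𝒢 : Type u} [Groupoid.{v} 𝒢] {ℋ : Type u} [Groupoid.{v} ℋ] (F : 𝒢 ⥤ ℋ)

/-- Pull-back of invariant forms along a morphism of groupoids (the derivative of `F` is the
unique linear map between zero spaces). -/
def pullForm (p : ℕ) : Form ℋ p →ₗ[ℂ] Form 𝒢 p where
  toFun ω := ⟨fun x => ω.1 (F.obj x), mem_form _ fun _ _ f => form_map ω (F.map f)⟩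
  map_add' _ _ := rfl
  map_smul' _ _ := rfl

/-- Pull-back in cohomology. -/
def pull : deRhamTotal ℋ →ₗ[ℂ] deRhamTotal 𝒢 :=
  DirectSum.lmap fun p => descend ((cls p).comp (pullForm F p))

variable [Finite 𝒢] [∀ x y : 𝒢, Finite (x ⟶ y)] [∀ x y : ℋ, Finite (x ⟶ y)]

/-- Push-forward of forms, by orbifold integration over the (homotopy) fibres of `F`.  The fibre
over `y` is the groupoid of pairs `(x, α : F x ⟶ y)`; orbifold integration of a function over a
finite groupoid weights each isomorphism class of objects by the inverse order of its local group,
which amounts to weighting each object by the inverse of the number of arrows issuing from it. -/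
def pushForm (p : ℕ) : Form 𝒢 p →ₗ[ℂ] Form ℋ p where
  toFun ω := ⟨fun y => ∑ᶠ a : Σ x : 𝒢, (F.obj x ⟶ y),
      (Nat.card (Σ z : 𝒢, (a.1 ⟶ z)) : ℂ)⁻¹ • ω.1 a.1,
    mem_form _ fun y z f => by
      refine (finsum_eq_of_bijective
        (fun a : Σ x : 𝒢, (F.obj x ⟶ y) => (⟨a.1, a.2 ≫ f⟩ : Σ x : 𝒢, (F.obj x ⟶ z)))
        ⟨?_, ?_⟩ ?_).symm
      · rintro ⟨a, g⟩ ⟨b, h⟩ e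
        obtain ⟨rfl, e⟩ := Sigma.mk.inj e
        have e' : g = h := (cancel_mono f).1 (eq_of_heq e)
        rw [e']
      · rintro ⟨a, g⟩
        exact ⟨⟨a, g ≫ Groupoid.inv f⟩, by simp⟩
      · intro a; rfl⟩
  map_add' a b := Subtype.ext (funext fun y => by
    refine Eq.trans (finsum_congr fun x => smul_add _ _ _) ?_
    exact finsum_add_distrib (Set.toFinite _) (Set.toFinite _))
  map_smul' c a := Subtype.ext (funext fun y => by
    refine Eq.trans (finsum_congr fun x => smul_comm _ c _) ?_
    exact (smul_finsum' c (Set.toFinite _)).symm)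

/-- Push-forward in cohomology. -/
def push : deRhamTotal 𝒢 →ₗ[ℂ] deRhamTotal ℋ :=
  DirectSum.lmap fun p => descend ((cls p).comp (pushForm F p))

end Functoriality

/-! ### The obstruction bundle and the Chen–Ruan product -/

/-- The age `∑_θ θ · dim E(θ)` of an automorphism `Φ` of finite order of a complex vector space,
where `E(θ)` is the eigenspace of `Φ` for `exp (2πiθ)`, `θ ∈ ℚ ∩ (0, 1)`.  It is the rank of the
rational combination `∑_θ θ E(θ)`. -/
def age {V : Type w} [AddCommGroup V] [Module ℂ V] (Φ : Module.End ℂ V) : ℚ :=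
  ∑ᶠ θ : Set.Ioo (0 : ℚ) 1, θ.1 *
    (Module.finrank ℂ (Φ.eigenspace (Complex.exp (2 * Real.pi * Complex.I * ((θ.1 : ℚ) : ℂ)))) : ℚ)

section ChenRuanProduct

variable {𝒢 : Type u} [Groupoid.{v} 𝒢]

/-- The degree shifting number `ι` at a point `(x, g)` of the inertia groupoid: the age of the
action of `g` on `T_x 𝒢₀` (on the normal space to the fixed part, the eigenvalue `1` not
contributing). -/
def degreeShift (a : Inertia 𝒢) : ℚ := age (tangentMap (a.loop 0)).toLinearMap

/-- The tangent space to the groupoid of `k`-sectors, as a subspace of `T_x 𝒢₀`: the vectors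
fixed by all of `g₁, …, g_k`. -/
def sectorTangent {k : ℕ} (s : Sector 𝒢 k) : Submodule ℂ Tan :=
  ⨅ i, LinearMap.ker ((tangentMap (s.loop i)).toLinearMap - LinearMap.id)

/-- The rank, at a point `s = (x, g₁, g₂)`, of the obstruction bundle `E`, which is given by
`E = e₁^* 𝒩_Φ + e₂^* 𝒩_Φ + e₁₂^* 𝒩_{Φ⁻¹} - 𝒩` in rational K-theory, `𝒩` being the normal bundle
of the groupoid of `2`-sectors. -/
def obstructionRank (s : Sector 𝒢 2) : ℚ :=
  degreeShift ((e₁ 𝒢).obj s) + degreeShift ((e₂ 𝒢).obj s) + degreeShift (invol ((e₁₂ 𝒢).obj s))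
    - Module.finrank ℂ (Tan ⧸ sectorTangent s)

theorem obstructionRank_congr (s t : Sector 𝒢 2) : obstructionRank s = obstructionRank t := rfl

open Classical in
/-- The Euler class of the obstruction bundle.  The Euler class of a complex vector bundle of rank
`r` lies in degree `2 r`, so in dimension zero it is `1` over the components over which the rank
is `0`, and it is `0` over the others. -/
def eulerForm (𝒢 : Type u) [Groupoid.{v} 𝒢] : Form (Sector 𝒢 2) 0 :=
  ⟨fun s => ContinuousAlternatingMap.constOfIsEmpty ℝ Tan (Fin 0)
      (if obstructionRank s = 0 then (1 : ℂ) else 0),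
    mem_form _ fun s t _ => by rw [obstructionRank_congr s t]⟩

/-- The class `e(E)` in `H^*` of the groupoid of `2`-sectors. -/
def eulerClass (𝒢 : Type u) [Groupoid.{v} 𝒢] : deRhamTotal (Sector 𝒢 2) :=
  DirectSum.of (fun p => deRham (Sector 𝒢 2) p) 0 (cls 0 (eulerForm 𝒢))

end ChenRuanProduct

/-- The underlying vector space of the Chen–Ruan cohomology: the cohomology of the inertia
groupoid.  (A class of degree `p` supported on the sector of `(x, g)` has Chen–Ruan degree
`p + 2 ι(x, g)`; this only changes the grading.) -/
def ChenRuanCohomology (𝒢 : Type u) [Groupoid.{v} 𝒢] : Type (max u v) := deRhamTotal (Inertia 𝒢)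

section ChenRuanRing

variable (𝒢 : Type u) [Groupoid.{v} 𝒢]

instance : AddCommGroup (ChenRuanCohomology 𝒢) :=
  inferInstanceAs (AddCommGroup (deRhamTotal (Inertia 𝒢)))

instance : Module ℂ (ChenRuanCohomology 𝒢) :=
  inferInstanceAs (Module ℂ (deRhamTotal (Inertia 𝒢)))

variable {𝒢} [Finite 𝒢] [∀ x y : 𝒢, Finite (x ⟶ y)]

/-- The Chen–Ruan product
`ω₁ *_CR ω₂ = (e₁₂)_* (e₁^* ω₁ ∪ e₂^* ω₂ ∪ e(E))`. -/
def chenRuanMul (a b : deRhamTotal (Inertia 𝒢)) : deRhamTotal (Inertia 𝒢) :=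
  push (e₁₂ 𝒢) (pull (e₁ 𝒢) a * pull (e₂ 𝒢) b * eulerClass 𝒢)

theorem chenRuanMul_add (a b c : deRhamTotal (Inertia 𝒢)) :
    chenRuanMul a (b + c) = chenRuanMul a b + chenRuanMul a c := by
  simp only [chenRuanMul, map_add, mul_add, add_mul]

theorem add_chenRuanMul (a b c : deRhamTotal (Inertia 𝒢)) :
    chenRuanMul (a + b) c = chenRuanMul a c + chenRuanMul b c := by
  simp only [chenRuanMul, map_add, add_mul]

theorem chenRuanMul_zero (a : deRhamTotal (Inertia 𝒢)) : chenRuanMul a 0 = 0 := by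
  simp only [chenRuanMul, map_zero, zero_mul, mul_zero]

theorem zero_chenRuanMul (a : deRhamTotal (Inertia 𝒢)) : chenRuanMul 0 a = 0 := by
  simp only [chenRuanMul, map_zero, zero_mul]

/-- The Chen–Ruan cohomology with its product. -/
instance : NonUnitalNonAssocRing (ChenRuanCohomology 𝒢) where
  mul := chenRuanMul (𝒢 := 𝒢)
  left_distrib := chenRuanMul_add (𝒢 := 𝒢)
  right_distrib := add_chenRuanMul (𝒢 := 𝒢)
  zero_mul := zero_chenRuanMul (𝒢 := 𝒢)
  mul_zero := chenRuanMul_zero (𝒢 := 𝒢)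

end ChenRuanRing

/-! ### Quotient orbifolds by finite groups -/

/-- The objects of the action groupoid `X ⋊ G`. -/
structure ActionGroupoid (G : Type u) (X : Type u) where
  pt : X

/-- The action groupoid `X ⋊ G` presenting `[X/G]`: the arrow `(x, g)` leads from `x` to
`g⁻¹ • x`, and `(x, g) · (g⁻¹ • x, h) = (x, g h)`. -/
instance (G X : Type u) [Group G] [MulAction G X] : Groupoid.{u} (ActionGroupoid G X) where
  Hom x y := {g : G // g • y.pt = x.pt}
  id x := ⟨1, one_smul G x.pt⟩
  comp f g := ⟨f.1 * g.1, by rw [mul_smul, g.2, f.2]⟩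
  inv f := ⟨f.1⁻¹, inv_smul_eq_iff.2 f.2.symm⟩
  id_comp f := Subtype.ext (one_mul f.1)
  comp_id f := Subtype.ext (mul_one f.1)
  assoc f g h := Subtype.ext (mul_assoc f.1 g.1 h.1)
  inv_comp f := Subtype.ext (inv_mul_cancel f.1)
  comp_inv f := Subtype.ext (mul_inv_cancel f.1)

instance (G X : Type u) [Finite X] : Finite (ActionGroupoid G X) :=
  Finite.of_injective (fun x => x.pt) (by rintro ⟨x⟩ ⟨y⟩ h; cases h; rfl)

instance (G X : Type u) [Group G] [MulAction G X] [Finite G] (x y : ActionGroupoid G X) :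
    Finite (x ⟶ y) :=
  inferInstanceAs (Finite {g : G // g • y.pt = x.pt})

instance (G : Type u) [Finite G] : Finite (ConjAct G) := inferInstanceAs (Finite G)

/-- The groupoid presenting the orbifold `[G/G]`: `G` acting on itself by conjugation. -/
abbrev ConjGroupoid (G : Type u) [Group G] := ActionGroupoid (ConjAct G) G

/-! ### Invariant functions on commuting pairs -/

section CommutingPairs

/-- The set `G̃` of commuting pairs in `G`. -/
def CommPair (G : Type u) [Group G] : Type u := {p : G × G // p.1 * p.2 = p.2 * p.1}

variable (G : Type u) [Group G]

/-- Simultaneous conjugation on commuting pairs. -/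
def CommPair.conj {G : Type u} [Group G] (k : G) (p : CommPair G) : CommPair G :=
  ⟨(k * p.1.1 * k⁻¹, k * p.1.2 * k⁻¹), by
    have h := p.2
    show k * p.1.1 * k⁻¹ * (k * p.1.2 * k⁻¹) = k * p.1.2 * k⁻¹ * (k * p.1.1 * k⁻¹)
    calc _ = k * (p.1.1 * p.1.2) * k⁻¹ := by group
      _ = k * (p.1.2 * p.1.1) * k⁻¹ := by rw [h]
      _ = _ := by group⟩

/-- The commuting pair `(g, h)` for `h` in the centralizer `Z_G(g)`. -/
def CommPair.mk' {G : Type u} [Group G] (g : G) (h : Subgroup.centralizer {g}) : CommPair G :=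
  ⟨(g, h.1), Subgroup.mem_centralizer_iff.1 h.2 g rfl⟩

/-- The `G`-invariant complex-valued functions on `G̃`, as a subspace of all functions. -/
def invariantSubmodule : Submodule ℂ (CommPair G → ℂ) where
  carrier := {f | ∀ (k : G) (p : CommPair G), f (p.conj k) = f p}
  zero_mem' _ _ := rfl
  add_mem' ha hb k p := by rw [Pi.add_apply, Pi.add_apply, ha k p, hb k p]
  smul_mem' c _ ha k p := by rw [Pi.smul_apply, Pi.smul_apply, ha k p]

/-- The vector space of `G`-invariant functions on `G̃`. -/
def InvariantFun : Type u := invariantSubmodule G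

instance : AddCommGroup (InvariantFun G) := inferInstanceAs (AddCommGroup (invariantSubmodule G))

instance : Module ℂ (InvariantFun G) := inferInstanceAs (Module ℂ (invariantSubmodule G))

instance : FunLike (InvariantFun G) (CommPair G) ℂ where
  coe f := f.1
  coe_injective _ _ h := Subtype.ext h

variable {G}

theorem InvariantFun.apply_conj (f : InvariantFun G) (k : G) (p : CommPair G) :
    f (p.conj k) = f p := f.2 k p

theorem InvariantFun.add_apply (f₁ f₂ : InvariantFun G) (p : CommPair G) :
    (f₁ + f₂) p = f₁ p + f₂ p := rfl

/-- The pairs `(h₁, h₂)` of elements of `Z_G(g)` with `h₁ h₂ = h`. -/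
abbrev Factorization (g h : G) : Type u :=
  {q : Subgroup.centralizer {g} × Subgroup.centralizer {g} // (q.1 * q.2 : G) = h}

/-- The function `(g, h) ↦ ∑_{h₁, h₂ ∈ Z_G(g), h₁ h₂ = h} f₁ (g, h₁) f₂ (g, h₂)`. -/
def starFun (f₁ f₂ : CommPair G → ℂ) (p : CommPair G) : ℂ :=
  ∑ᶠ q : Factorization p.1.1 p.1.2,
    f₁ (CommPair.mk' p.1.1 q.1.1) * f₂ (CommPair.mk' p.1.1 q.1.2)

/-- Conjugation as an equivalence between centralizers. -/
def conjCentralizer (k g : G) :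
    Subgroup.centralizer {g} ≃ Subgroup.centralizer {k * g * k⁻¹} where
  toFun h := ⟨k * h.1 * k⁻¹, Subgroup.mem_centralizer_iff.2 (by
    rintro _ rfl
    have := Subgroup.mem_centralizer_iff.1 h.2 g rfl
    calc _ = k * (g * h.1) * k⁻¹ := by group
      _ = k * (h.1 * g) * k⁻¹ := by rw [this]
      _ = _ := by group)⟩
  invFun h := ⟨k⁻¹ * h.1 * k, Subgroup.mem_centralizer_iff.2 (by
    rintro _ rfl
    have := Subgroup.mem_centralizer_iff.1 h.2 _ rfl
    rename_i y
    calc _ = k⁻¹ * ((k * y * k⁻¹) * h.1) * k := by group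
      _ = k⁻¹ * (h.1 * (k * y * k⁻¹)) * k := by rw [this]
      _ = _ := by group)⟩
  left_inv h := Subtype.ext (by simp [mul_assoc])
  right_inv h := Subtype.ext (by simp [mul_assoc])

theorem conj_mk' (k g : G) (h : Subgroup.centralizer {g}) :
    (CommPair.mk' g h).conj k = CommPair.mk' (k * g * k⁻¹) (conjCentralizer k g h) := rfl

/-- The product `*₂`: convolution in the second variable over the centralizer of the first. -/
def InvariantFun.star (f₁ f₂ : InvariantFun G) : InvariantFun G :=
  ⟨starFun f₁ f₂, fun k p => by
    symm
    refine finsum_eq_of_bijective (fun q : Factorization p.1.1 p.1.2 =>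
      (⟨(conjCentralizer k _ q.1.1, conjCentralizer k _ q.1.2), by
        show k * q.1.1.1 * k⁻¹ * (k * q.1.2.1 * k⁻¹) = k * p.1.2 * k⁻¹
        have h : q.1.1.1 * q.1.2.1 = p.1.2 := q.2
        calc _ = k * (q.1.1.1 * q.1.2.1) * k⁻¹ := by group
          _ = _ := by rw [h]⟩ : Factorization (p.conj k).1.1 (p.conj k).1.2)) ⟨?_, ?_⟩ ?_
    · rintro ⟨⟨a, b⟩, h⟩ ⟨⟨a', b'⟩, h'⟩ e
      have e1 := congrArg (fun q => q.1.1) e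
      have e2 := congrArg (fun q => q.1.2) e
      have e1' := (conjCentralizer k _).injective e1
      have e2' := (conjCentralizer k _).injective e2
      exact Subtype.ext (Prod.ext e1' e2')
    · rintro ⟨⟨a, b⟩, h⟩
      refine ⟨⟨((conjCentralizer k _).symm a, (conjCentralizer k _).symm b), ?_⟩, ?_⟩
      · show k⁻¹ * a.1 * k * (k⁻¹ * b.1 * k) = p.1.2
        have h' : a.1 * b.1 = k * p.1.2 * k⁻¹ := h
        calc _ = k⁻¹ * (a.1 * b.1) * k := by group
          _ = _ := by rw [h']; group
      · exact Subtype.ext (Prod.ext ((conjCentralizer k _).apply_symm_apply a)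
          ((conjCentralizer k _).apply_symm_apply b))
    · intro q
      rw [← f₁.apply_conj k, ← f₂.apply_conj k]; rfl⟩

instance : Mul (InvariantFun G) := ⟨InvariantFun.star⟩

theorem InvariantFun.mul_apply (f₁ f₂ : InvariantFun G) (p : CommPair G) :
    (f₁ * f₂) p = ∑ᶠ q : Factorization p.1.1 p.1.2,
      f₁ (CommPair.mk' p.1.1 q.1.1) * f₂ (CommPair.mk' p.1.1 q.1.2) := rfl

theorem InvariantFun.ext_mk' {f₁ f₂ : InvariantFun G}
    (h : ∀ (g : G) (a : Subgroup.centralizer {g}),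
      f₁ (CommPair.mk' g a) = f₂ (CommPair.mk' g a)) : f₁ = f₂ :=
  DFunLike.ext _ _ fun p => h p.1.1 ⟨p.1.2, Subgroup.mem_centralizer_iff.2 (by
    rintro _ rfl; exact p.2)⟩

theorem InvariantFun.mul_mk' (f₁ f₂ : InvariantFun G) (g : G) (a : Subgroup.centralizer {g}) :
    (f₁ * f₂) (CommPair.mk' g a) = ∑ᶠ b : Subgroup.centralizer {g},
      f₁ (CommPair.mk' g b) * f₂ (CommPair.mk' g (b⁻¹ * a)) := by
  rw [InvariantFun.mul_apply]
  refine finsum_eq_of_bijective (fun q => q.1.1) ⟨?_, ?_⟩ ?_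
  · rintro ⟨⟨b, c⟩, h⟩ ⟨⟨b', c'⟩, h'⟩ e
    obtain rfl : b = b' := e
    have : c = c' := Subtype.ext (mul_left_cancel (h.trans h'.symm))
    subst this
    rfl
  · intro b
    exact ⟨⟨(b, b⁻¹ * a), by
      show b.1 * (b.1⁻¹ * a.1) = a.1
      rw [mul_inv_cancel_left]⟩, rfl⟩
  · rintro ⟨⟨b, c⟩, h⟩
    have key : ∀ b c : Subgroup.centralizer {g}, (b * c : G) = a → c = b⁻¹ * a := fun b c h => by
      rw [eq_inv_mul_iff_mul_eq]
      exact Subtype.ext h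
    obtain rfl := key b c h
    rfl

open Classical in
instance : One (InvariantFun G) :=
  ⟨⟨fun p => if p.1.2 = 1 then 1 else 0, fun k p => by
    have : k * p.1.2 * k⁻¹ = 1 ↔ p.1.2 = 1 := by
      rw [mul_inv_eq_one, mul_eq_left]
    show (if k * p.1.2 * k⁻¹ = 1 then (1 : ℂ) else 0) = _
    simp only [this]⟩⟩

open Classical in
theorem InvariantFun.one_mk' (g : G) (a : Subgroup.centralizer {g}) :
    (1 : InvariantFun G) (CommPair.mk' g a) = if a = 1 then 1 else 0 := by
  show (if a.1 = 1 then (1 : ℂ) else 0) = _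
  simp

/-- The ring of `G`-invariant functions on `G̃` with the product `*₂`. -/
instance [Finite G] : Ring (InvariantFun G) where
  zero_mul f := InvariantFun.ext_mk' fun g a => by
    rw [InvariantFun.mul_mk']
    exact (finsum_congr fun b => zero_mul _).trans finsum_zero
  mul_zero f := InvariantFun.ext_mk' fun g a => by
    rw [InvariantFun.mul_mk']
    exact (finsum_congr fun b => mul_zero _).trans finsum_zero
  left_distrib f₁ f₂ f₃ := InvariantFun.ext_mk' fun g a => by
    simp only [InvariantFun.mul_mk', InvariantFun.add_apply, mul_add]
    exact finsum_add_distrib (Set.toFinite _) (Set.toFinite _)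
  right_distrib f₁ f₂ f₃ := InvariantFun.ext_mk' fun g a => by
    simp only [InvariantFun.mul_mk', InvariantFun.add_apply, add_mul]
    exact finsum_add_distrib (Set.toFinite _) (Set.toFinite _)
  one_mul f := InvariantFun.ext_mk' fun g a => by
    rw [InvariantFun.mul_mk', finsum_eq_single _ 1]
    · simp [InvariantFun.one_mk']
    · intro b hb
      simp [InvariantFun.one_mk', hb]
  mul_one f := InvariantFun.ext_mk' fun g a => by
    rw [InvariantFun.mul_mk', finsum_eq_single _ a]
    · simp [InvariantFun.one_mk']
    · intro b hb
      simp [InvariantFun.one_mk', inv_mul_eq_one, hb]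
  mul_assoc f₁ f₂ f₃ := InvariantFun.ext_mk' fun g a => by
    have := Fintype.ofFinite (Subgroup.centralizer {g})
    simp only [InvariantFun.mul_mk', finsum_eq_sum_of_fintype, Finset.sum_mul, Finset.mul_sum]
    rw [Finset.sum_comm]
    refine Finset.sum_congr rfl fun b _ => ?_
    refine Fintype.sum_equiv (Equiv.mulLeft b⁻¹) _ _ fun c => ?_
    simp [mul_assoc]
  neg_add_cancel := neg_add_cancel
  zsmul := fun n f => n • f
  nsmul := fun n f => n • f
  nsmul_zero := zero_nsmul
  nsmul_succ := fun n f => succ_nsmul f n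
  zsmul_zero' := zero_zsmul
  zsmul_succ' := SubNegMonoid.zsmul_succ'
  zsmul_neg' := SubNegMonoid.zsmul_neg'
  sub_eq_add_neg := sub_eq_add_neg

end CommutingPairs

end ChenRuan

end

/-! The tangent spaces are zero, so only degree zero survives: a cohomology class is the same as a
function on objects that is constant along arrows (`zeroClass_surjective`, `value_ext`,
`value_map`). In terms of these functions the cup product is pointwise, pull-back is composition,
and the Euler class is the constant `1`, since the obstruction bundle has rank zero (`value_mul`,
`value_pull`, `value_eulerClass`).

The only real content is integration along `e₁₂`. Its homotopy fibre over a loop `g` at `x` splits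
as the arrows into `x` times the factorizations `g = g₁ g₂` (`e₁₂FibreEquiv`). The integrand depends
only on the factorization, and every weight is the inverse of the number of arrows into `x`. The
first factor therefore has total mass `1`, and the product is convolution of loops
(`value_chenRuanMul`).

For `[G/G]`, the loops at `g` form `Z_G(g)` and arrows of the inertia groupoid act by simultaneous
conjugation, so this convolution is `*₂`. -/

noncomputable section
namespace ChenRuan
universe u v w

/-! ### Cohomology classes as functions on objects -/

section Value

variable {𝒢 : Type u} [Groupoid.{v} 𝒢] {ℋ : Type u} [Groupoid.{v} ℋ]

/-- The form of degree zero given by a function which is constant along arrows. -/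
def formOfFun (f : 𝒢 → ℂ) (h : ∀ x y : 𝒢, (x ⟶ y) → f y = f x) : Form 𝒢 0 :=
  ⟨fun x => ContinuousAlternatingMap.constOfIsEmpty ℝ Tan (Fin 0) (f x),
    mem_form _ fun x y k => by rw [h x y k]⟩

/-- The value of a form of degree zero at a point. -/
def formValue (x : 𝒢) : Form 𝒢 0 →ₗ[ℂ] ℂ where
  toFun ω := ω.1 x 0
  map_add' _ _ := rfl
  map_smul' _ _ := rfl

theorem formValue_ext {ω η : Form 𝒢 0} (h : ∀ x, formValue x ω = formValue x η) : ω = η :=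
  Subtype.ext <| funext fun x => ContinuousAlternatingMap.ext fun m => by
    rw [Subsingleton.elim m 0]
    exact h x

theorem formValue_map (ω : Form 𝒢 0) {x y : 𝒢} (f : x ⟶ y) :
    formValue y ω = formValue x ω :=
  congrArg (fun a : Tan [⋀^Fin 0]→L[ℝ] ℂ => a 0) (form_map ω f)

/-- The value at a point of a class, that is, of its component of degree zero. -/
def value (x : 𝒢) : deRhamTotal 𝒢 →ₗ[ℂ] ℂ :=
  (descend (formValue x)).comp (DirectSum.component ℂ ℕ (fun p => deRham 𝒢 p) 0)

/-- The class of a form of degree zero. -/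
def zeroClass (ω : Form 𝒢 0) : deRhamTotal 𝒢 :=
  DirectSum.of (fun p => deRham 𝒢 p) 0 (cls 0 ω)

theorem value_zeroClass (x : 𝒢) (ω : Form 𝒢 0) : value x (zeroClass ω) = formValue x ω := by
  exact congrArg (descend (formValue x)) 
    (DirectSum.of_eq_same (β := fun p => deRham 𝒢 p) 0 (cls 0 ω))

/-- A nonempty tuple of vectors in the zero space contains a zero vector, so forms of positive
degree vanish and a class is determined by its degree-zero component. -/
theorem zeroClass_surjective : Function.Surjective (zeroClass (𝒢 := 𝒢)) := by
  intro a
  obtain ⟨ω, h⟩ := cls_surjective 0 (a 0)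
  refine ⟨ω, DFinsupp.ext fun p => ?_⟩
  cases p with
  | zero =>
    rw [← h]
    exact DirectSum.of_eq_same 0 _
  | succ p =>
    obtain ⟨η, hη⟩ := cls_surjective (p + 1) (zeroClass ω (p + 1))
    obtain ⟨η', hη'⟩ := cls_surjective (p + 1) (a (p + 1))
    exact hη.symm.trans ((congrArg _ (Subsingleton.elim _ _)).trans hη')

theorem value_ext {a b : deRhamTotal 𝒢} (h : ∀ x, value x a = value x b) : a = b := by
  obtain ⟨ω, rfl⟩ := zeroClass_surjective a
  obtain ⟨η, rfl⟩ := zeroClass_surjective b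
  simp only [value_zeroClass] at h
  rw [formValue_ext h]

theorem value_map (a : deRhamTotal 𝒢) {x y : 𝒢} (f : x ⟶ y) : value y a = value x a := by
  obtain ⟨ω, rfl⟩ := zeroClass_surjective a
  simp only [value_zeroClass, formValue_map ω f]

/-- Alternatizing the tensor product gives `0! · 0! = 1` times the shuffle sum defining the wedge,
and the empty index type has a single permutation, so one term remains. -/
theorem wedge_zero_apply (a b : Tan [⋀^Fin 0]→L[ℝ] ℂ) (v : Fin 0 → Tan) :
    wedge a b v = a 0 * b 0 := by
  have key : a.toAlternatingMap.domCoprod b.toAlternatingMap =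
      MultilinearMap.alternatization
        ((a.toAlternatingMap : MultilinearMap ℝ (fun _ : Fin 0 => Tan) ℂ).domCoprod
          (b.toAlternatingMap : MultilinearMap ℝ (fun _ : Fin 0 => Tan) ℂ)) := by
    rw [MultilinearMap.domCoprod_alternization_eq]
    simp
  have h : wedge a b v = LinearMap.mul' ℝ ℂ
      ((a.toAlternatingMap.domCoprod b.toAlternatingMap) (v ∘ finSumFinEquiv)) := rfl
  rw [h, key, MultilinearMap.alternatization_apply, Fintype.sum_unique]
  simp only [Subsingleton.elim (default : Equiv.Perm (Fin 0 ⊕ Fin 0)) 1]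
  simp
  congr 1 <;> exact congrArg _ (Subsingleton.elim _ _)

theorem value_mul (x : 𝒢) (a b : deRhamTotal 𝒢) : value x (a * b) = value x a * value x b := by
  obtain ⟨ω, rfl⟩ := zeroClass_surjective a
  obtain ⟨η, rfl⟩ := zeroClass_surjective b
  -- The wedge lies in degree `0 + 0`, which reduces to `0` by definition, so no cast is needed.
  have : zeroClass ω * zeroClass η = zeroClass (wedgeForm ω η : Form 𝒢 0) :=
    DirectSum.of_mul_of _ _
  rw [this]
  simp only [value_zeroClass]
  exact wedge_zero_apply _ _ _

theorem value_pull (F : 𝒢 ⥤ ℋ) (x : 𝒢) (a : deRhamTotal ℋ) :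
    value x (pull F a) = value (F.obj x) a := by
  obtain ⟨ω, rfl⟩ := zeroClass_surjective a
  have : pull F (zeroClass ω) = zeroClass (pullForm F 0 ω) :=
    DirectSum.lmap_lof (R := ℂ) (fun p => descend ((cls p).comp (pullForm F p))) 0 (cls 0 ω)
  rw [this]
  simp only [value_zeroClass]
  rfl

theorem value_push (F : 𝒢 ⥤ ℋ) [Finite 𝒢] [∀ x y : 𝒢, Finite (x ⟶ y)]
    [∀ x y : ℋ, Finite (x ⟶ y)] (y : ℋ) (a : deRhamTotal 𝒢) :
    value y (push F a) = ∑ᶠ b : Σ x : 𝒢, (F.obj x ⟶ y),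
      (Nat.card (Σ z : 𝒢, (b.1 ⟶ z)) : ℂ)⁻¹ * value b.1 a := by
  obtain ⟨ω, rfl⟩ := zeroClass_surjective a
  have : push F (zeroClass ω) = zeroClass (pushForm F 0 ω) :=
    DirectSum.lmap_lof (R := ℂ) (fun p => descend ((cls p).comp (pushForm F p))) 0 (cls 0 ω)
  rw [this]
  simp only [value_zeroClass]
  -- Evaluation at the empty tuple is additive, so it passes through the finite sum over the fibre.
  let ev : (Tan [⋀^Fin 0]→L[ℝ] ℂ) →+ ℂ := ⟨⟨fun a => a 0, rfl⟩, fun _ _ => rfl⟩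
  exact ev.map_finsum (Set.toFinite _)

theorem age_eq_zero {V : Type w} [AddCommGroup V] [Module ℂ V] [Subsingleton V]
    (Φ : Module.End ℂ V) : age Φ = 0 := by
  refine (finsum_congr fun θ => ?_).trans finsum_zero
  rw [Module.finrank_zero_of_subsingleton, Nat.cast_zero, mul_zero]

/-- All ages and the normal bundle are computed in a zero space. -/
theorem obstructionRank_eq_zero (s : Sector 𝒢 2) : obstructionRank s = 0 := by
  have : Subsingleton (Tan ⧸ sectorTangent s) := (Submodule.mkQ_surjective _).subsingleton
  simp [obstructionRank, degreeShift, age_eq_zero, Module.finrank_zero_of_subsingleton]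

theorem value_eulerClass (s : Sector 𝒢 2) : value s (eulerClass 𝒢) = 1 := by
  refine (value_zeroClass s (eulerForm 𝒢)).trans ?_
  exact if_pos (obstructionRank_eq_zero s)

end Value

/-! ### Integration over the fibres of `e₁₂` -/

section ChenRuanProduct

variable {𝒢 : Type u} [Groupoid.{v} 𝒢]

/-- The arrows issuing from a multi-sector are those issuing from the underlying point. -/
def sectorArrowsEquiv {k : ℕ} (s : Sector 𝒢 k) :
    (Σ t : Sector 𝒢 k, (s ⟶ t)) ≃ Σ x : 𝒢, (s.pt ⟶ x) where
  toFun a := ⟨a.1.pt, a.2.1⟩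
  invFun a := ⟨⟨a.1, fun i => Groupoid.inv a.2 ≫ s.loop i ≫ a.2⟩, ⟨a.2, fun _ => rfl⟩⟩
  left_inv := by
    rintro ⟨⟨x, l⟩, ⟨(f : s.pt ⟶ x), h⟩⟩
    -- The loops at the target are forced by the arrow.
    obtain rfl : l = fun i => Groupoid.inv f ≫ s.loop i ≫ f := funext h
    rfl
  right_inv _ := rfl

theorem inv_conj_conj_inv {x y : 𝒢} (f : x ⟶ y) (a : y ⟶ y) :
    Groupoid.inv f ≫ (f ≫ a ≫ Groupoid.inv f) ≫ f = a := by
  simp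

theorem conj_inv_conj {x y : 𝒢} (f : x ⟶ y) (a : x ⟶ x) :
    f ≫ (Groupoid.inv f ≫ a ≫ f) ≫ Groupoid.inv f = a := by
  simp

/-- Points of the homotopy fibre of `e₁₂` agree if their loops and arrows do. -/
theorem e₁₂Fibre_ext {y : Inertia 𝒢} {x : 𝒢} {l l' : Fin 2 → (x ⟶ x)} (hl : l = l')
    {f : (e₁₂ 𝒢).obj ⟨x, l⟩ ⟶ y} {f' : (e₁₂ 𝒢).obj ⟨x, l'⟩ ⟶ y} (hf : f.1 = f'.1) :
    (⟨⟨x, l⟩, f⟩ : Σ s : Sector 𝒢 2, ((e₁₂ 𝒢).obj s ⟶ y)) = ⟨⟨x, l'⟩, f'⟩ := by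
  subst hl
  exact congrArg (Sigma.mk _) (Subtype.ext hf)

/-- The homotopy fibre of `e₁₂` over `(x, g)`: an arrow into `x` together with a factorization of
`g` into two loops. -/
def e₁₂FibreEquiv (y : Inertia 𝒢) : (Σ s : Sector 𝒢 2, ((e₁₂ 𝒢).obj s ⟶ y)) ≃
    (Σ x : 𝒢, (x ⟶ y.pt)) × {q : (y.pt ⟶ y.pt) × (y.pt ⟶ y.pt) // q.1 ≫ q.2 = y.loop 0} where
  toFun b := (⟨b.1.pt, b.2.1⟩,
    ⟨(Groupoid.inv b.2.1 ≫ b.1.loop 0 ≫ b.2.1, Groupoid.inv b.2.1 ≫ b.1.loop 1 ≫ b.2.1), by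
      refine Eq.trans ?_ (b.2.2 0).symm
      simp [e₁₂]⟩)
  invFun c := ⟨⟨c.1.1, ![c.1.2 ≫ c.2.1.1 ≫ Groupoid.inv c.1.2,
      c.1.2 ≫ c.2.1.2 ≫ Groupoid.inv c.1.2]⟩, ⟨c.1.2, fun i => by
      obtain rfl : i = 0 := Subsingleton.elim _ _
      refine c.2.2.symm.trans ?_
      show c.2.1.1 ≫ c.2.1.2 = Groupoid.inv c.1.2 ≫ ((c.1.2 ≫ c.2.1.1 ≫ Groupoid.inv c.1.2) ≫
        c.1.2 ≫ c.2.1.2 ≫ Groupoid.inv c.1.2) ≫ c.1.2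
      simp⟩⟩
  left_inv := by
    rintro ⟨⟨x, l⟩, ⟨f, h⟩⟩
    refine e₁₂Fibre_ext (funext fun i => ?_) rfl
    fin_cases i
    · exact conj_inv_conj f (l 0)
    · exact conj_inv_conj f (l 1)
  right_inv := by
    rintro ⟨⟨x, f⟩, ⟨⟨a, b⟩, h⟩⟩
    exact Prod.ext rfl (Subtype.ext (Prod.ext (inv_conj_conj_inv f a) (inv_conj_conj_inv f b)))

variable [Finite 𝒢] [∀ x y : 𝒢, Finite (x ⟶ y)]

/-- The Chen–Ruan product in dimension zero is convolution of loops. -/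
theorem value_chenRuanMul (a b : deRhamTotal (Inertia 𝒢)) (y : Inertia 𝒢) :
    value y (chenRuanMul a b) =
      ∑ᶠ q : {q : (y.pt ⟶ y.pt) × (y.pt ⟶ y.pt) // q.1 ≫ q.2 = y.loop 0},
        value (⟨y.pt, fun _ => q.1.1⟩ : Inertia 𝒢) a *
          value (⟨y.pt, fun _ => q.1.2⟩ : Inertia 𝒢) b := by
  have : Fintype (Σ x : 𝒢, (x ⟶ y.pt)) := Fintype.ofFinite _
  have : Fintype {q : (y.pt ⟶ y.pt) × (y.pt ⟶ y.pt) // q.1 ≫ q.2 = y.loop 0} := Fintype.ofFinite _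
  -- Given `f` from `x` to `y.pt`, the map `g ↦ g⁻¹ f` turns arrows out of `x` into arrows into
  -- `y.pt`. Hence the weight is the same at every point of the fibre.
  have hcard : ∀ x : 𝒢, (x ⟶ y.pt) →
      Nat.card (Σ z : 𝒢, (x ⟶ z)) = Fintype.card (Σ x : 𝒢, (x ⟶ y.pt)) := fun x f => by
    rw [← Nat.card_eq_fintype_card]
    exact Nat.card_congr (Equiv.sigmaCongrRight fun z =>
      ⟨fun g => Groupoid.inv g ≫ f, fun g => f ≫ Groupoid.inv g, fun g => by simp,
        fun g => by simp⟩)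
  have hne : (Fintype.card (Σ x : 𝒢, (x ⟶ y.pt)) : ℂ) ≠ 0 :=
    Nat.cast_ne_zero.2 (@Fintype.card_ne_zero _ _ ⟨⟨y.pt, 𝟙 _⟩⟩)
  rw [chenRuanMul, value_push]
  have key : ∀ c : Σ s : Sector 𝒢 2, ((e₁₂ 𝒢).obj s ⟶ y),
      (Nat.card (Σ z : Sector 𝒢 2, (c.1 ⟶ z)) : ℂ)⁻¹ *
        value c.1 (pull (e₁ 𝒢) a * pull (e₂ 𝒢) b * eulerClass 𝒢) =
      (Fintype.card (Σ x : 𝒢, (x ⟶ y.pt)) : ℂ)⁻¹ *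
        (value (⟨y.pt, fun _ => (e₁₂FibreEquiv y c).2.1.1⟩ : Inertia 𝒢) a *
          value (⟨y.pt, fun _ => (e₁₂FibreEquiv y c).2.1.2⟩ : Inertia 𝒢) b) := by
    rintro ⟨s, f⟩
    rw [Nat.card_congr (sectorArrowsEquiv s), hcard s.pt f.1, value_mul, value_mul,
      value_eulerClass, mul_one, value_pull, value_pull]
    congr 2
    -- The arrow `f` of the fibre point carries each loop of `s` to its conjugate at `y.pt`, where
    -- invariance of the class gives the same value.
    · exact (value_map a (show (e₁ 𝒢).obj s ⟶
        ⟨y.pt, fun _ => (e₁₂FibreEquiv y ⟨s, f⟩).2.1.1⟩ from ⟨f.1, fun _ => rfl⟩)).symm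
    · exact (value_map b (show (e₂ 𝒢).obj s ⟶
        ⟨y.pt, fun _ => (e₁₂FibreEquiv y ⟨s, f⟩).2.1.2⟩ from ⟨f.1, fun _ => rfl⟩)).symm
  rw [finsum_congr key, finsum_eq_of_bijective (e₁₂FibreEquiv y) (e₁₂FibreEquiv y).bijective
    (g := fun c => (Fintype.card (Σ x : 𝒢, (x ⟶ y.pt)) : ℂ)⁻¹ *
        (value (⟨y.pt, fun _ => c.2.1.1⟩ : Inertia 𝒢) a *
          value (⟨y.pt, fun _ => c.2.1.2⟩ : Inertia 𝒢) b)) fun _ => rfl,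
    finsum_eq_sum_of_fintype, finsum_eq_sum_of_fintype, Fintype.sum_prod_type]
  -- The summand ignores the arrow into `y.pt`, so summing over such arrows multiplies by their
  -- number and cancels the weight.
  simp only [← Finset.mul_sum, Finset.sum_const, Finset.card_univ, nsmul_eq_mul]
  rw [mul_left_comm, mul_inv_cancel_left₀ hne]

end ChenRuanProduct

/-! ### The inertia groupoid of `[G/G]` and commuting pairs -/

section ConjugationQuotient

variable {G : Type u} [Group G]

/-- The point `(g, h)` of the inertia groupoid given by a commuting pair. -/
def CommPair.toInertia (p : CommPair G) : Inertia (ConjGroupoid G) :=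
  ⟨⟨p.1.1⟩, fun _ => ⟨ConjAct.toConjAct p.1.2, by
    rw [ConjAct.toConjAct_smul, ← p.2, mul_inv_cancel_right]⟩⟩

/-- The commuting pair given by a point of the inertia groupoid. -/
def inertiaPair (a : Inertia (ConjGroupoid G)) : CommPair G :=
  ⟨(a.pt.pt, ConjAct.ofConjAct (a.loop 0).1), by
    have h := (a.loop 0).2
    rw [ConjAct.smul_def, mul_inv_eq_iff_eq_mul] at h
    exact h.symm⟩

theorem toInertia_inertiaPair (a : Inertia (ConjGroupoid G)) : (inertiaPair a).toInertia = a := by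
  obtain ⟨⟨x⟩, l⟩ := a
  refine congrArg (Sector.mk _) (funext fun i => ?_)
  obtain rfl : i = 0 := Subsingleton.elim _ _
  rfl

/-- Conjugation by `k` as an arrow of the inertia groupoid. -/
def conjArrow (k : G) (p : CommPair G) : (p.conj k).toInertia ⟶ p.toInertia :=
  ⟨⟨ConjAct.toConjAct k, ConjAct.toConjAct_smul _ _⟩, fun _ => Subtype.ext (by
    show p.1.2 = k⁻¹ * ((k * p.1.2 * k⁻¹) * k)
    group)⟩

/-- An arrow of the action groupoid moves its target to its source, so the source pair is the
conjugate. This makes an invariant function on pairs constant along arrows. -/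
theorem inertiaPair_map {a b : Inertia (ConjGroupoid G)} (f : a ⟶ b) :
    inertiaPair a = (inertiaPair b).conj (ConjAct.ofConjAct f.1.1) := by
  have h1 : ConjAct.ofConjAct f.1.1 * b.pt.pt * (ConjAct.ofConjAct f.1.1)⁻¹ = a.pt.pt := f.1.2
  have h2 : ConjAct.ofConjAct (b.loop 0).1 = (ConjAct.ofConjAct f.1.1)⁻¹ *
    (ConjAct.ofConjAct (a.loop 0).1 * ConjAct.ofConjAct f.1.1) := congrArg Subtype.val (f.2 0)
  refine Subtype.ext (Prod.ext h1.symm ?_)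
  show ConjAct.ofConjAct (a.loop 0).1 = _ * ConjAct.ofConjAct (b.loop 0).1 * _
  rw [h2]
  group

/-- The loops at `g` in the action groupoid form the centralizer of `g`. -/
def loopEquiv (g : G) : ((⟨g⟩ : ConjGroupoid G) ⟶ ⟨g⟩) ≃ Subgroup.centralizer {g} where
  toFun l := ⟨ConjAct.ofConjAct l.1, Subgroup.mem_centralizer_iff.2 (by
    rintro _ rfl
    exact (inertiaPair ⟨_, fun _ => l⟩).2)⟩
  invFun h := (CommPair.mk' g h).toInertia.loop 0
  left_inv _ := rfl
  right_inv _ := rfl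

/-- Cohomology classes of the inertia groupoid of `[G/G]` as invariant functions on commuting
pairs. -/
def invariantFunEquiv (G : Type u) [Group G] :
    deRhamTotal (Inertia (ConjGroupoid G)) ≃ₗ[ℂ] InvariantFun G where
  toFun a := ⟨fun p => value p.toInertia a, fun k p => (value_map a (conjArrow k p)).symm⟩
  map_add' a b := Subtype.ext (funext fun _ => map_add _ a b)
  map_smul' c a := Subtype.ext (funext fun _ => map_smul _ c a)
  invFun f := zeroClass (formOfFun (fun x => f (inertiaPair x)) fun x y k => by
    rw [inertiaPair_map k, f.apply_conj])
  left_inv a := value_ext fun x => by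
    rw [value_zeroClass]
    show value (inertiaPair x).toInertia a = _
    rw [toInertia_inertiaPair]
  right_inv f := Subtype.ext (funext fun p => value_zeroClass _ _)

/-- Composition of loops in diagrammatic order is multiplication in `G` in the same order, so
`loopEquiv` in both coordinates matches the factorizations on the two sides, and the summands agree
by definition. -/
theorem invariantFunEquiv_mul [Finite G] (a b : deRhamTotal (Inertia (ConjGroupoid G))) :
    invariantFunEquiv G (chenRuanMul a b) = invariantFunEquiv G a * invariantFunEquiv G b := by
  refine DFunLike.ext _ _ fun p => ?_
  rw [InvariantFun.mul_apply]
  refine (value_chenRuanMul a b p.toInertia).trans ?_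
  let e := (loopEquiv p.1.1).prodCongr (loopEquiv p.1.1)
  exact finsum_eq_of_bijective (e.subtypeEquiv (fun q => Subtype.ext_iff))
    (Equiv.bijective _) fun _ => rfl

end ConjugationQuotient

end ChenRuan

end

theorem mainTheorem5 (G : Type*) [Group G] [Finite G] :
    ∃ φ : ChenRuan.ChenRuanCohomology (ChenRuan.ConjGroupoid G) ≃+* ChenRuan.InvariantFun G,
      ∀ (c : ℂ) (a : ChenRuan.ChenRuanCohomology (ChenRuan.ConjGroupoid G)),
        φ (c • a) = c • φ a :=
  ⟨{ (ChenRuan.invariantFunEquiv G).toAddEquiv with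
      map_mul' := ChenRuan.invariantFunEquiv_mul }, (ChenRuan.invariantFunEquiv G).map_smul⟩
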